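/- Let $m,n\geq 1$ be integers. For a commutative ring $R$ and matrices $A\in M_{mn,m}(R)$, $B\in M_{mn,n}(R)$ with entries $a_{ij}$, $b_{ij}$, let $A\star B\in M_{mn,mn}(R)$ be the matrix whose $i$-th row is $$(a_{i1}b_{i1},\ldots,a_{im}b_{i1},\,a_{i1}b_{i2},\ldots,a_{im}b_{i2},\,\ldots,\,a_{i1}b_{in},\ldots,a_{im}b_{in}).$$ A tableau of shape $n^m$ is a bijective filling, by $1,\ldots,mn$, of a rectangular array of boxes with $m$ rows and $n$ columns; it is standard if its entries increase along rows and down columns. A tableau of shape $m^n$ is defined in the same way with $n$ rows and $m$ columns, and the conjugate $\gamma'$ of a tableau $\gamma$ is its reflection in the main diagonal. A permutation $\sigma\in\Sigma_{mn}$ acts on a tableau by permuting its entries, and $\varepsilon(\sigma)$ is its sign. For a tableau $\alpha$ of shape $n^m$ and a tableau $\beta$ of shape $m^n$ (standard or not) put $$A_\alpha=\prod_{i=1}^n\det A_{\mathrm{col}_i(\alpha)},\qquad B_\beta=\prod_{j=1}^m\det B_{\mathrm{col}_j(\beta)},$$ where $A_{\mathrm{col}_i(\alpha)}$ is the $m\times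 m$ matrix formed by the rows of $A$ whose indices are the entries of the $i$-th column of $\alpha$, taken from top to bottom, and similarly $B_{\mathrm{col}_j(\beta)}$ is the $n\times n$ matrix formed by the rows of $B$ indexed by the $j$-th column of $\beta$. Let $1_{n^m}$ be the standard tableau of shape $n^m$ filled consecutively, first from top to bottom and then from left to right. The sign $\varepsilon(\gamma)$ of a tableau $\gamma$ of shape $n^m$ is the sign of the permutation taking $1_{n^m}$ to $\gamma$. Two tableaux are column-equivalent if they differ only by permuting the elements in each column. The Fayers number $\langle\alpha,\beta\rangle$ of standard tableaux $\alpha$ of shape $n^m$ and $\beta$ of shape $m^n$ is $0$ if two distinct numbers lie in a common column of $\alpha$ and in a common column of $\beta$; otherwise there is a unique tableau $\gamma$ of shape $n^m$ such that $\gamma$ is column-equivalent to $\alpha$ and $\gamma'$ is column-equivalent to $\beta$, and $\langle\alpha,\beta\rangle=\varepsilon(\gamma)$. Theorem. For all standard tableaux $\alpha$ of shape $n^m$ and $\beta$ of shape $m^n$ there is an integer $\kappa_{\alpha,\beta}$, depending only on $\alpha$ and $\beta$, such that for every commutative ring $R$ and all $A\in M_{mn,m}(R)$, $B\in M_{mn,n}(R)$,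 $$\kappa_{\alpha,\beta}\,\det(A\star B)=\sum_{\sigma\in\Sigma_{mn}}\varepsilon(\sigma)\,A_{\sigma\alpha}\,B_{\sigma\beta}.$$ The integer $\kappa_{\alpha,\beta}$ vanishes if and only if $\langle\alpha,\beta\rangle=0$. If $m\geq n$, $\alpha=1_{n^m}$ and $\beta=(1_{n^m})'$ is its conjugate, then $$\kappa_{\alpha,\beta}=H_{m,n}=\prod_{i=0}^{n-1}\frac{(m+i)!}{i!},$$ and this is the product of the hook lengths of the boxes of the rectangular diagram with $m$ rows and $n$ columns. -/

import Mathlib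

/-- A (not necessarily standard) tableau of rectangular shape with `r` rows and `c` columns: a
bijective filling of the boxes by `N` numbers. The box `(i, j)` lies in row `i` and column `j`;
rows, columns and entries are numbered from `0`. -/
abbrev Tableau (r c N : ℕ) := Fin r × Fin c ≃ Fin N

namespace Tableau

variable {r c N : ℕ}

/-- Entries increase along every row (left to right) and down every column. -/
def IsStandard (t : Tableau r c N) : Prop :=
  (∀ i : Fin r, StrictMono fun j : Fin c => t (i, j)) ∧
    ∀ j : Fin c, StrictMono fun i : Fin r => t (i, j)

/-- The conjugate tableau, reflected along the main diagonal. -/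
def conj (t : Tableau r c N) : Tableau c r N := (Equiv.prodComm (Fin c) (Fin r)).trans t

/-- The symmetric group acts on tableaux by permuting the entries. -/
def act (σ : Equiv.Perm (Fin N)) (t : Tableau r c N) : Tableau r c N := t.trans σ

/-- The column of `t` which contains the number `k`. -/
def colOf (t : Tableau r c N) (k : Fin N) : Fin c := (t.symm k).2

/-- Column equivalence: the tableaux differ only by permutations inside each column. -/
def ColEquiv (s t : Tableau r c N) : Prop := ∀ k : Fin N, s.colOf k = t.colOf k

/-- Some two distinct numbers lie in a common column of `α` and in a common column of `β`. -/
def CommonColPair (α : Tableau r c N) (β : Tableau c r N) : Prop :=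
  ∃ k l : Fin N, k ≠ l ∧ α.colOf k = α.colOf l ∧ β.colOf k = β.colOf l

theorem IsStandard.conj {t : Tableau r c N} (h : t.IsStandard) : t.conj.IsStandard :=
  ⟨fun i => h.2 i, fun j => h.1 j⟩

theorem existsUnique_colEquiv {α : Tableau r c N} {β : Tableau c r N}
    (h : ¬ CommonColPair α β) :
    ∃! γ : Tableau r c N, ColEquiv γ α ∧ ColEquiv γ.conj β := by
  let f : Fin N → Fin r × Fin c := fun k => (β.colOf k, α.colOf k)
  have hf : Function.Injective f := by
    intro k l hkl
    by_contra hne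
    exact h ⟨k, l, hne, (Prod.ext_iff.mp hkl).2, (Prod.ext_iff.mp hkl).1⟩
  have hb : Function.Bijective f :=
    (Fintype.bijective_iff_injective_and_card f).2 ⟨hf, (Fintype.card_congr α).symm⟩
  refine ⟨(Equiv.ofBijective f hb).symm, ⟨fun k => rfl, fun k => rfl⟩, ?_⟩
  rintro γ ⟨h1, h2⟩
  refine Equiv.symm_bijective.injective (Equiv.ext fun k => Prod.ext ?_ ?_)
  · exact h2 k
  · exact h1 k

/-- The column-by-column bijection `(a, b) ↦ a + m * b` (indices starting at `0`), that is, the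
tableau `1_{n^m}` filled first from top to bottom, then from left to right. -/
def one (m n : ℕ) : Tableau m n (m * n) :=
  (Equiv.prodComm (Fin m) (Fin n)).trans (finProdFinEquiv.trans (finCongr (Nat.mul_comm n m)))

theorem one_val (m n : ℕ) (a : Fin m) (b : Fin n) :
    ((one m n (a, b) : Fin (m * n)) : ℕ) = a + m * b := rfl

theorem one_isStandard (m n : ℕ) : (one m n).IsStandard := by
  refine ⟨fun i j j' hj => ?_, fun j i i' hi => ?_⟩
  · have hm : 0 < m := Nat.lt_of_le_of_lt (Nat.zero_le _) i.isLt
    have := Nat.mul_lt_mul_of_pos_left (Fin.lt_def.mp hj) hm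
    simp only [Fin.lt_def, one_val]
    omega
  · simp only [Fin.lt_def, one_val]
    have := Fin.lt_def.mp hi
    omega

/-- The sign of a tableau `γ` of shape `n^m`: the sign of the permutation taking `1_{n^m}`
to `γ`. -/
def sign {m n : ℕ} (γ : Tableau m n (m * n)) : ℤ :=
  Equiv.Perm.sign ((one m n).symm.trans γ)

open Classical in
/-- The Fayers number `⟨α, β⟩ ∈ {-1, 0, 1}`: it is `0` if two numbers lie in a common column of
`α` and a common column of `β`, and otherwise it is the sign of the unique tableau `γ` which is
column-equivalent to `α` and whose conjugate is column-equivalent to `β`. -/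
noncomputable def fayers {m n : ℕ} (α : Tableau m n (m * n)) (β : Tableau n m (m * n)) : ℤ :=
  if h : CommonColPair α β then 0 else sign (existsUnique_colEquiv h).choose

/-- For a matrix `M` with rows indexed by the entries of `t` and as many columns as `t` has rows,
the product over the columns of `t` of the minor of `M` given by the rows with indices in that
column, taken from top to bottom. -/
def colMinors {R : Type*} [CommRing R] (M : Matrix (Fin N) (Fin r) R) (t : Tableau r c N) : R :=
  ∏ j : Fin c, (M.submatrix (fun i : Fin r => t (i, j)) id).det

end Tableau

/-- Standard tableaux with `r` rows and `c` columns. -/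
def StandardTableau (r c N : ℕ) := {t : Tableau r c N // t.IsStandard}

namespace StandardTableau

/-- The conjugate of a standard tableau. -/
def conj {r c N : ℕ} (t : StandardTableau r c N) : StandardTableau c r N :=
  ⟨t.1.conj, t.2.conj⟩

/-- The standard tableau `1_{n^m}`, with `m` rows and `n` columns. -/
def one (m n : ℕ) : StandardTableau m n (m * n) := ⟨Tableau.one m n, Tableau.one_isStandard m n⟩

end StandardTableau

/-- The amalgam `A ⋆ B`: its `i`-th row is the Kronecker product of the `i`-th rows of `A` and `B`,
ordered as `a₁b₁, …, a_m b₁, a₁b₂, …, a_m b₂, …, a₁b_n, …, a_m b_n`. -/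
def amalgam {R : Type*} [CommRing R] {m n : ℕ} (A : Matrix (Fin (m * n)) (Fin m) R)
    (B : Matrix (Fin (m * n)) (Fin n) R) : Matrix (Fin (m * n)) (Fin (m * n)) R :=
  Matrix.of fun i k =>
    A i ((Tableau.one m n).symm k).1 * B i ((Tableau.one m n).symm k).2

/-- `H_{m,n} = ∏_{i=0}^{n-1} (m+i)!/i!`. -/
def hookNumber (m n : ℕ) : ℚ :=
  ∏ i ∈ Finset.range n, ((m + i).factorial : ℚ) / (i.factorial : ℚ)

/-- The hook length of a box of the rectangular diagram with `r` rows and `c` columns: the number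
of boxes weakly to the right of it in its row or weakly below it in its column. -/
def hookLength {r c : ℕ} (x : Fin r × Fin c) : ℕ :=
  (Finset.univ.filter fun y : Fin r × Fin c =>
    (y.1 = x.1 ∧ x.2 ≤ y.2) ∨ (y.2 = x.2 ∧ x.1 ≤ y.1)).card

/-!
Why the identity holds. Expanding all minors by the Leibniz formula, the signed sum over the
symmetric group becomes a sum of determinants of matrices obtained from `A ⋆ B` by a self-map of
its columns, and each of these is `det (A ⋆ B)` times the sign of the self-map, where `mapSign`
extends the sign of permutations by zero (`det_amalgam_mul_amalgamCoeff`). This gives an integer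
coefficient which depends only on the tableaux.

If two numbers lie in a common column of both tableaux, their transposition makes the terms cancel
in pairs (`amalgamCoeff_eq_zero`). Otherwise `α` and `β` may be replaced by `γ` and `γ'`, and these
by `1_{n^m}` and its conjugate, at the cost of signs only, so that everything rests on the
coefficient of the last pair being the nonzero number `∏_{s=1}^n s (s+1) ⋯ (s+m-1)`
(`amalgamCoeff_one`).

That coefficient is a sum over families of permutations `π j` of the rows and `ρ i` of the columns,
and it is the polarised form of `det(∂)^n det(X)^n` for an `m × m` matrix `X`. It is evaluated by
`n` applications of Cayley's identity `det(∂) det(X)^s = s (s+1) ⋯ (s+m-1) det(X)^(s-1)`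
(`omegaSum_one`). For the proof of the latter, differentiate `det ^ s` at `G` once in each row, in
the direction of the rows of a matrix `V`, and antisymmetrise in the rows of `V`. The result is
alternating, hence equal to `det V` times its value at `V = 1`. At `V = G` all determinants are
`± det G` or `0`, and what remains is `det G ^ s` times the number of pairs of a permutation `π` of
`m` points and a map `w` from these points to `s` points with `w ∘ π = w`. Cancelling `det G` for the
generic matrix gives the identity for all matrices. The passage from `det G ^ s`, with equal factors,
to the polarised form, where each row of `G` is a sum of independent vectors, is by
inclusion-exclusion over the subsets of these vectors (`sum_weight_prod_det_eq_polarDet`).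
-/

open Finset Matrix

/-! ### The sign of a self-map -/

section MapSign

variable {ι R : Type*} [Fintype ι] [DecidableEq ι] [CommRing R]

/-- The sign of a permutation, extended by zero to all self-maps of `ι`. It is encoded as the
determinant of the `0`-`1` matrix whose `i`-th row is the basis vector `e_{f i}`. -/
def mapSign (f : ι → ι) : ℤ := ((1 : Matrix ι ι ℤ).submatrix f id).det

theorem det_submatrix_left (M : Matrix ι ι R) (f : ι → ι) :
    (M.submatrix f id).det = (mapSign f : R) * M.det := by
  have h : M.submatrix f id = ((1 : Matrix ι ι ℤ).submatrix f id).map (Int.cast : ℤ → R) * M := by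
    ext i j
    simp [Matrix.mul_apply, Matrix.one_apply]
  rw [h, det_mul, mapSign]
  congr 1
  exact ((Int.castRingHom R).map_det _).symm

theorem det_submatrix_right (M : Matrix ι ι R) (f : ι → ι) :
    (M.submatrix id f).det = M.det * (mapSign f : R) := by
  rw [← det_transpose, transpose_submatrix, det_submatrix_left, det_transpose, mul_comm]

theorem mapSign_comp (f g : ι → ι) : mapSign (f ∘ g) = mapSign f * mapSign g := by
  have h : (1 : Matrix ι ι ℤ).submatrix (f ∘ g) id
      = ((1 : Matrix ι ι ℤ).submatrix f id).submatrix g id := rfl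
  rw [mapSign, h, det_submatrix_left, mul_comm]
  simp [mapSign]

theorem mapSign_perm (σ : Equiv.Perm ι) : mapSign σ = Equiv.Perm.sign σ := by
  rw [mapSign, det_permute, det_one, mul_one, Int.cast_id]

theorem mapSign_eq_zero {f : ι → ι} {i j : ι} (hij : i ≠ j) (h : f i = f j) : mapSign f = 0 :=
  det_zero_of_row_eq hij (by ext k; rw [submatrix_apply, submatrix_apply, h])

theorem perm_sign_mul_self (σ : Equiv.Perm ι) :
    (Equiv.Perm.sign σ : ℤ) * (Equiv.Perm.sign σ : ℤ) = 1 := by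
  rw [← Units.val_mul, Int.units_mul_self, Units.val_one]

/-- The Leibniz formula with the permutation acting on the column index. -/
theorem det_eq_sum_prod_row (M : Matrix ι ι R) :
    M.det = ∑ τ : Equiv.Perm ι, ((Equiv.Perm.sign τ : ℤ) : R) * ∏ i, M i (τ i) := by
  rw [← det_transpose, det_apply']
  rfl

/-- A product of determinants, expanded by the Leibniz formula. -/
theorem prod_det_eq_sum {K : Type*} [Fintype K] [DecidableEq K] (M : K → Matrix ι ι R) :
    ∏ k, (M k).det = ∑ τ : K → Equiv.Perm ι,
      (∏ k, ((Equiv.Perm.sign (τ k) : ℤ) : R)) * ∏ k, ∏ i, M k i (τ k i) := by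
  simp_rw [det_eq_sum_prod_row, prod_univ_sum, Fintype.piFinset_univ, prod_mul_distrib]

end MapSign

/-! ### Cayley's identity -/

section Cayley

variable {ι R K : Type*} [Fintype ι] [DecidableEq ι] [CommRing R] [Fintype K] [DecidableEq K]

theorem prod_ite_eq_mul {w : K} (a b : K → R) :
    ∏ k, (if w = k then a k else b k) = a w * ∏ k, if w = k then 1 else b k := by
  have h : ∀ k, (if w = k then a k else b k)
      = (if w = k then a k else 1) * (if w = k then 1 else b k) := by
    intro k; split_ifs <;> simp
  rw [prod_congr rfl fun k _ => h k, prod_mul_distrib, prod_ite_eq]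
  simp

/-- The polarised form of `det(∂) det(X)^|K|` at `G`, with the rows of `V` as directions: each
row of `V` replaces a row of one of `|K|` copies of `G`, antisymmetrised over the rows of `V`. -/
def omegaSum (K : Type*) [Fintype K] [DecidableEq K] (G V : Matrix ι ι R) : R :=
  ∑ π : Equiv.Perm ι, ((Equiv.Perm.sign π : ℤ) : R) *
    ∑ w : ι → K, ∏ k, (Matrix.of fun i => if w i = k then V (π i) else G i).det

/-- `omegaSum` is alternating in the rows of `V`, hence a multiple of `det V`. -/
theorem omegaSum_eq_det_mul (G V : Matrix ι ι R) :
    omegaSum K G V = V.det * omegaSum K G 1 := by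
  have key : ∀ W : Matrix ι ι R, omegaSum K G W = W.det *
      ∑ w : ι → K, ∑ τ : K → Equiv.Perm ι, ((∏ k, ((Equiv.Perm.sign (τ k) : ℤ) : R)) *
        ∏ i, ∏ k, if w i = k then 1 else G i (τ k i)) *
        (mapSign fun i => τ (w i) i : R) := by
    intro W
    simp_rw [omegaSum, mul_sum]
    rw [sum_comm]
    refine sum_congr rfl fun w _ => ?_
    simp_rw [prod_det_eq_sum, mul_sum]
    rw [sum_comm]
    refine sum_congr rfl fun τ _ => ?_
    rw [mul_left_comm, ← det_submatrix_right, det_apply', mul_sum]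
    refine sum_congr rfl fun π _ => ?_
    have h : ∏ k, ∏ i, (Matrix.of fun i => if w i = k then W (π i) else G i) i (τ k i)
        = (∏ i, W (π i) (τ (w i) i)) * ∏ i, ∏ k, if w i = k then 1 else G i (τ k i) := by
      rw [prod_comm, ← prod_mul_distrib]
      refine prod_congr rfl fun i _ => ?_
      rw [← prod_ite_eq_mul (fun k => W (π i) (τ k i))]
      refine prod_congr rfl fun k _ => ?_
      simp only [of_apply]
      split_ifs <;> rfl
    rw [h]
    simp only [submatrix_apply, id]
    ring
  rw [key V, key 1, det_one, one_mul]

/-- If `w` is constant on the cycles of `π`, then `π` is the product of its restrictions to the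
fibres of `w`; otherwise some restriction, continued by the identity, is not injective. -/
theorem sign_mul_prod_mapSign (π : Equiv.Perm ι) (w : ι → K) :
    (Equiv.Perm.sign π : ℤ) * ∏ k, mapSign (fun i => if w i = k then π i else i)
      = if w ∘ π = w then 1 else 0 := by
  split_ifs with h
  · have hw : ∀ i, w (π i) = w i := fun i => congrFun h i
    have key : ∀ S : Finset K, ∏ k ∈ S, mapSign (fun i => if w i = k then π i else i)
        = mapSign (fun i => if w i ∈ S then π i else i) := by
      intro S
      induction S using Finset.induction_on with
      | empty =>
        have := mapSign_perm (1 : Equiv.Perm ι)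
        simpa [Equiv.Perm.coe_one, Function.id_def] using this.symm
      | insert a S ha ih =>
        rw [prod_insert ha, ih, ← mapSign_comp]
        congr 1
        funext i
        by_cases hS : w i ∈ S
        · have : w i ≠ a := fun e => ha (e ▸ hS)
          simp [hS, hw, this]
        · simp [hS]
    rw [key]
    simp only [mem_univ, if_true]
    rw [mapSign_perm, perm_sign_mul_self]
  · obtain ⟨i, hi⟩ := Function.ne_iff.1 h
    have hi' : w (π i) ≠ w i := hi
    rw [prod_eq_zero (mem_univ (w i)), mul_zero]
    refine mapSign_eq_zero (i := i) (j := π i) ?_ ?_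
    · intro e
      exact hi' (by rw [← e])
    · simp [hi']

/-- Counted by the sizes of the fibres, pairs of a map and a permutation preserving it satisfy the
recursion of the ascending factorial: a new point enters the fibre over `k`, and multiplies the
number of fibre-preserving permutations by one more than the size of that fibre. -/
theorem sum_prod_factorial_card_fiber [Nonempty K] (N : ℕ) :
    ∑ w : Fin N → K, ∏ k, (Fintype.card {i // w i = k}).factorial
      = (Fintype.card K).ascFactorial N := by
  induction N with
  | zero => simp
  | succ N ih =>
    rw [Nat.ascFactorial_succ, ← ih, mul_sum, ← (Fin.consEquiv fun _ => K).sum_comp,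
      Fintype.sum_prod_type, sum_comm]
    refine sum_congr rfl fun w _ => ?_
    have hc : ∀ (a k : K), Fintype.card {i // (Fin.cons a w : Fin (N + 1) → K) i = k}
        = (if a = k then 1 else 0) + Fintype.card {i // w i = k} := by
      intro a k
      simp only [Fintype.card_subtype, Finset.card_filter, Fin.sum_univ_succ, Fin.cons_zero,
        Fin.cons_succ]
    have hp : ∀ a : K, ∏ k, (Fintype.card {i // (Fin.cons a w : Fin (N + 1) → K) i = k}).factorial
        = (Fintype.card {i // w i = a} + 1) * ∏ k, (Fintype.card {i // w i = k}).factorial := by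
      intro a
      have h1 : ∀ k, (Fintype.card {i // (Fin.cons a w : Fin (N + 1) → K) i = k}).factorial
          = (if a = k then Fintype.card {i // w i = k} + 1 else 1)
            * (Fintype.card {i // w i = k}).factorial := by
        intro k
        rw [hc]
        split_ifs
        · rw [add_comm, Nat.factorial_succ]
        · simp
      rw [prod_congr rfl fun k _ => h1 k, prod_mul_distrib, prod_ite_eq]
      simp
    have hs : ∑ a, Fintype.card {i // w i = a} = N := by
      have := Fintype.card_congr (Equiv.sigmaFiberEquiv w)
      rwa [Fintype.card_sigma, Fintype.card_fin] at this
    simp only [Fin.consEquiv_apply]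
    rw [sum_congr rfl fun a _ => hp a, ← sum_mul, sum_add_distrib, hs]
    simp [add_comm]

theorem sum_perm_sum_comp_eq [Nonempty K] :
    ∑ π : Equiv.Perm ι, ∑ w : ι → K, (if w ∘ π = w then (1 : ℤ) else 0)
      = (Fintype.card K).ascFactorial (Fintype.card ι) := by
  have e := (Fintype.equivFin ι)
  rw [← sum_prod_factorial_card_fiber, sum_comm]
  push_cast
  rw [← (e.arrowCongr (Equiv.refl K)).sum_comp]
  refine sum_congr rfl fun w _ => ?_
  have h1 : ∏ k, (Fintype.card {i // (e.arrowCongr (Equiv.refl K)) w i = k}).factorial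
      = ∏ k, (Fintype.card {i // w i = k}).factorial := by
    refine prod_congr rfl fun k _ => ?_
    congr 1
    exact Fintype.card_congr (e.symm.subtypeEquiv fun i => by simp)
  rw [← Nat.cast_prod, h1, ← DomMulAct.stabilizer_card w, Fintype.card_subtype, sum_boole]

/-- The case `V = G`, where every determinant is a multiple of `det G`. -/
theorem omegaSum_self [Nonempty K] (G : Matrix ι ι R) :
    omegaSum K G G
      = G.det ^ Fintype.card K * ((Fintype.card K).ascFactorial (Fintype.card ι) : R) := by
  have h : ∀ (π : Equiv.Perm ι) (w : ι → K) (k : K),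
      (Matrix.of fun i => if w i = k then G (π i) else G i)
        = G.submatrix (fun i => if w i = k then π i else i) id := by
    intro π w k
    ext i j
    simp only [of_apply, submatrix_apply, id]
    split_ifs <;> rfl
  have h2 : (((Fintype.card K).ascFactorial (Fintype.card ι) : ℕ) : R)
      = (((Fintype.card K).ascFactorial (Fintype.card ι) : ℤ) : R) := by norm_cast
  rw [h2, ← sum_perm_sum_comp_eq, omegaSum]
  simp_rw [h, det_submatrix_left, prod_mul_distrib, prod_const, card_univ]
  push_cast
  simp_rw [mul_sum]
  refine sum_congr rfl fun π _ => sum_congr rfl fun w _ => ?_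
  have := congrArg (Int.cast : ℤ → R) (sign_mul_prod_mapSign π w)
  push_cast at this
  rw [← this]
  ring

/-- Cayley's identity `det(∂) det(X)^(s+1) = (s+1)(s+2)⋯(s+m) det(X)^s`, where `m` is the size of
the matrix. -/
theorem omegaSum_one (s : ℕ) (G : Matrix ι ι R) :
    omegaSum (Fin (s + 1)) G 1
      = G.det ^ s * ((s + 1).ascFactorial (Fintype.card ι) : R) := by
  -- For the generic matrix over the integers, `det G` can be cancelled.
  have hgen : omegaSum (Fin (s + 1)) (mvPolynomialX ι ι ℤ) 1 = (mvPolynomialX ι ι ℤ).det ^ s *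
      ((s + 1).ascFactorial (Fintype.card ι) : MvPolynomial (ι × ι) ℤ) := by
    refine mul_left_cancel₀ (det_mvPolynomialX_ne_zero ι ℤ) ?_
    rw [← omegaSum_eq_det_mul, omegaSum_self, Fintype.card_fin, pow_succ']
    ring
  let f : MvPolynomial (ι × ι) ℤ →+* R :=
    MvPolynomial.eval₂Hom (Int.castRingHom R) fun p => G p.1 p.2
  have hf : ∀ i, (fun j => f (mvPolynomialX ι ι ℤ i j)) = G i := by
    intro i
    ext j
    simp [f]
  have hdet : f (mvPolynomialX ι ι ℤ).det = G.det := by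
    rw [RingHom.map_det]
    congr 1
    ext i j
    simp [f]
  have := congrArg f hgen
  rw [map_mul, map_pow, hdet, map_natCast] at this
  rw [← this]
  simp only [omegaSum, map_sum, map_mul, map_prod, map_intCast]
  refine sum_congr rfl fun π _ => congrArg _ <| sum_congr rfl fun w _ => prod_congr rfl fun k _ => ?_
  rw [RingHom.map_det]
  congr 1
  ext i j
  simp only [of_apply, RingHom.mapMatrix_apply, map_apply]
  split_ifs
  · simp [Matrix.one_apply, apply_ite f]
  · exact (congrFun (hf i) j).symm

end Cayley

/-! ### Polarisation of powers of the determinant -/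

section Polarization

variable {ι R : Type*} [Fintype ι] [DecidableEq ι] [CommRing R]

/-- The full polarisation of `det ^ |K|`: row `i` receives the `|K|` vectors `v i k`, which are
distributed over the `|K|` determinants in all possible ways. -/
def polarDet {K : Type*} [Fintype K] [DecidableEq K] (v : ι → K → ι → R) : R :=
  ∑ ρ : ι → Equiv.Perm K, ∏ k, (Matrix.of fun i => v i (ρ i k)).det

theorem det_sum_smul_row {J : Type*} [Fintype J] (a : ι → J → R) (v : ι → J → ι → R) :
    (Matrix.of fun i => ∑ j, a i j • v i j).det
      = ∑ φ : ι → J, (∏ i, a i (φ i)) * (Matrix.of fun i => v i (φ i)).det := by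
  classical
  have h := (detRowAlternating : (ι → R) [⋀^ι]→ₗ[R] R).toMultilinearMap.map_sum
    (fun i j => a i j • v i j)
  refine h.trans (sum_congr rfl fun φ _ => ?_)
  exact (detRowAlternating : (ι → R) [⋀^ι]→ₗ[R] R).toMultilinearMap.map_smul_univ
    (fun i => a i (φ i)) (fun i => v i (φ i))

/-- If the weights `c` and `a` detect the bijections among the self-maps of `K`, then the weighted
sum of products of determinants of linear combinations of the `v i j` is `polarDet v`. -/
theorem sum_weight_prod_det_eq_polarDet {X K : Type*} [Fintype X] [Fintype K] [DecidableEq K]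
    (c : X → R) (a : X → K → K → R)
    (h : ∀ f : K → K, ∑ x, c x * ∏ k, a x k (f k) = if Function.Bijective f then 1 else 0)
    (v : ι → K → ι → R) :
    ∑ x : ι → X, (∏ i, c (x i)) * ∏ k, (Matrix.of fun i => ∑ j, a (x i) k j • v i j).det
      = polarDet v := by
  classical
  simp_rw [det_sum_smul_row, prod_univ_sum, Fintype.piFinset_univ, mul_sum]
  rw [sum_comm, ← (Equiv.piComm fun (_ : ι) (_ : K) => K).sum_comp]
  have h1 : ∀ φ : ι → K → K,
      (∑ x : ι → X, (∏ i, c (x i)) * ∏ k, ((∏ i, a (x i) k (φ i k))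
        * (Matrix.of fun i => v i (φ i k)).det))
      = if ∀ i, Function.Bijective (φ i) then ∏ k, (Matrix.of fun i => v i (φ i k)).det
        else 0 := by
    intro φ
    have h2 : ∀ x : ι → X, (∏ i, c (x i)) * ∏ k, ((∏ i, a (x i) k (φ i k))
        * (Matrix.of fun i => v i (φ i k)).det)
        = (∏ i, (c (x i) * ∏ k, a (x i) k (φ i k)))
          * ∏ k, (Matrix.of fun i => v i (φ i k)).det := by
      intro x
      rw [prod_mul_distrib, prod_mul_distrib, prod_comm, mul_assoc]
    have h3 := prod_univ_sum (fun _ : ι => (univ : Finset X))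
      (fun i x => c x * ∏ k, a x k (φ i k))
    rw [Fintype.piFinset_univ] at h3
    rw [sum_congr rfl fun x _ => h2 x, ← sum_mul, ← h3, prod_congr rfl fun i _ => h (φ i)]
    split_ifs with hb
    · rw [prod_congr rfl fun i _ => if_pos (hb i), prod_const_one, one_mul]
    · obtain ⟨i, hi⟩ := not_forall.1 hb
      rw [prod_eq_zero (mem_univ i) (if_neg hi), zero_mul]
  refine (sum_congr rfl fun φ _ => h1 φ).trans ?_
  rw [← sum_filter, polarDet]
  symm
  refine sum_bij (fun ρ _ i => ⇑(ρ i)) ?_ ?_ ?_ ?_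
  · intro ρ _
    simp
  · intro ρ _ ρ' _ e
    funext i
    exact Equiv.coe_fn_injective (congrFun e i)
  · intro φ hφ
    have hb : ∀ i, Function.Bijective (φ i) := by simpa using hφ
    exact ⟨fun i => Equiv.ofBijective (φ i) (hb i), mem_univ _, rfl⟩
  · intro ρ _
    rfl

/-- Inclusion-exclusion: only the surjective self-maps contribute. -/
theorem sum_neg_one_pow_card_compl_prod_mem {K : Type*} [Fintype K] [DecidableEq K]
    (f : K → K) :
    ∑ S : Finset K, (-1 : R) ^ Sᶜ.card * ∏ k, (if f k ∈ S then (1 : R) else 0)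
      = if Function.Bijective f then 1 else 0 := by
  have h : ∀ S : Finset K, (∏ k, (if f k ∈ S then (1 : R) else 0))
      = if Sᶜ ⊆ (univ.image f)ᶜ then 1 else 0 := by
    intro S
    rw [prod_ite_zero, prod_const_one]
    congr 1
    simp only [mem_univ, true_imp_iff, mem_compl, subset_iff, mem_image, true_and, not_exists,
      eq_iff_iff]
    exact ⟨fun h x hx k e => hx (e ▸ h k), fun h k => by_contra fun hk => h hk k rfl⟩
  have hc : ∑ S : Finset K, (-1 : R) ^ Sᶜ.card * ∏ k, (if f k ∈ S then (1 : R) else 0)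
      = ∑ S : Finset K, if S ⊆ (univ.image f)ᶜ then (-1 : R) ^ S.card else 0 :=
    Fintype.sum_bijective Compl.compl compl_involutive.bijective _ _ fun S => by
      rw [h, mul_ite, mul_one, mul_zero]
  rw [hc, ← sum_filter]
  have h2 := congrArg (Int.cast : ℤ → R) (sum_powerset_neg_one_pow_card (x := (univ.image f)ᶜ))
  push_cast at h2
  have h3 : (univ.filter fun S : Finset K => S ⊆ (univ.image f)ᶜ) = (univ.image f)ᶜ.powerset := by
    ext S; simp
  rw [h3, h2]
  congr 1
  rw [compl_eq_empty_iff, eq_iff_iff, ← Finite.surjective_iff_bijective]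
  refine ⟨fun e k => ?_, image_univ_of_surjective⟩
  simpa using (e.symm ▸ mem_univ k : k ∈ univ.image f)

/-- The polarisation of `det ^ s` from its values on sums of the given vectors. -/
theorem sum_det_sum_pow_eq_polarDet {s : ℕ} (v : ι → Fin s → ι → R) :
    ∑ S : ι → Finset (Fin s), (∏ i, (-1 : R) ^ (S i)ᶜ.card)
        * (Matrix.of fun i => ∑ j ∈ S i, v i j).det ^ s
      = polarDet v := by
  rw [← sum_weight_prod_det_eq_polarDet (fun S : Finset (Fin s) => (-1 : R) ^ Sᶜ.card)
    (fun S _ j => if j ∈ S then 1 else 0) sum_neg_one_pow_card_compl_prod_mem v]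
  refine sum_congr rfl fun S _ => ?_
  simp

/-- A self-map of `Fin (s + 1)` is bijective if and only if it takes the value `0` at exactly one
point `w` and the rest of it is a bijection of `Fin s` after deleting `w` and `0`. -/
theorem sum_weight_succ {s : ℕ} (f : Fin (s + 1) → Fin (s + 1)) :
    ∑ x : Finset (Fin s) × Fin (s + 1), (-1 : R) ^ x.1ᶜ.card *
        ∏ k, (Fin.cons (if x.2 = k then 1 else 0)
          (fun j => if x.2 = k then 0 else if j ∈ x.1 then 1 else 0) : Fin (s + 1) → R) (f k)
      = if Function.Bijective f then 1 else 0 := by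
  classical
  rw [Fintype.sum_prod_type, sum_comm]
  have hzero : ∀ w, (f w ≠ 0 ∨ ∃ k, w ≠ k ∧ f k = 0) → ∑ S : Finset (Fin s),
      (-1 : R) ^ Sᶜ.card * ∏ k, (Fin.cons (if w = k then 1 else 0)
        (fun j => if w = k then 0 else if j ∈ S then 1 else 0) : Fin (s + 1) → R) (f k) = 0 := by
    intro w hw
    refine sum_eq_zero fun S _ => ?_
    rcases hw with hw | ⟨k, hk, hfk⟩
    · obtain ⟨j, hj⟩ := Fin.exists_succ_eq.2 hw
      rw [prod_eq_zero (mem_univ w), mul_zero]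
      rw [← hj, Fin.cons_succ, if_pos rfl]
    · rw [prod_eq_zero (mem_univ k), mul_zero]
      rw [hfk, Fin.cons_zero, if_neg hk]
  have hone : ∀ w, f w = 0 → (∀ k, w ≠ k → f k ≠ 0) → ∑ S : Finset (Fin s),
      (-1 : R) ^ Sᶜ.card * ∏ k, (Fin.cons (if w = k then 1 else 0)
        (fun j => if w = k then 0 else if j ∈ S then 1 else 0) : Fin (s + 1) → R) (f k)
      = if Function.Bijective f then 1 else 0 := by
    intro w h0 h1
    have hg : ∀ k : Fin s, ∃ j : Fin s, j.succ = f (w.succAbove k) := fun k =>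
      Fin.exists_succ_eq.2 (h1 _ (Fin.succAbove_ne w k).symm)
    choose g hg using hg
    have hbij : Function.Bijective f ↔ Function.Bijective g := by
      rw [← Finite.injective_iff_bijective, ← Finite.injective_iff_bijective]
      constructor
      · intro hf a b hab
        exact Fin.succAbove_right_injective (hf (by rw [← hg, ← hg, hab]))
      · intro hi a b hab
        rcases Fin.eq_self_or_eq_succAbove w a with ha | ⟨a, rfl⟩ <;>
          rcases Fin.eq_self_or_eq_succAbove w b with hb | ⟨b, rfl⟩
        · rw [ha, hb]
        · rw [ha, h0, ← hg] at hab
          exact absurd hab.symm (Fin.succ_ne_zero _)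
        · rw [hb, h0, ← hg] at hab
          exact absurd hab (Fin.succ_ne_zero _)
        · rw [← hg, ← hg] at hab
          rw [hi (Fin.succ_injective _ hab)]
    simp_rw [hbij]
    rw [← sum_neg_one_pow_card_compl_prod_mem g]
    refine sum_congr rfl fun S _ => ?_
    rw [Fin.prod_univ_succAbove _ w, h0, Fin.cons_zero, if_pos rfl, one_mul]
    congr 1
    refine prod_congr rfl fun k _ => ?_
    rw [← hg, Fin.cons_succ, if_neg (Fin.succAbove_ne w k).symm]
  by_cases hex : ∃ w, f w = 0 ∧ ∀ k, w ≠ k → f k ≠ 0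
  · obtain ⟨w, h0, h1⟩ := hex
    rw [sum_eq_single w, hone w h0 h1]
    · intro w' _ hw'
      exact hzero w' (Or.inl (h1 w' hw'.symm))
    · exact fun h => absurd (mem_univ w) h
  · rw [sum_eq_zero, if_neg]
    · intro hf
      obtain ⟨w, hw⟩ := hf.2 0
      exact hex ⟨w, hw, fun k hk e => hk (hf.1 (hw.trans e.symm))⟩
    · intro w _
      by_cases h0 : f w = 0
      · refine hzero w (Or.inr ?_)
        by_contra hno
        exact hex ⟨w, h0, fun k hk e => hno ⟨k, hk, e⟩⟩
      · exact hzero w (Or.inl h0)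

/-- The analogue of `sum_det_sum_pow_eq_polarDet` with one further vector `u i` for each
row, which enters exactly one of the `s + 1` determinants, the one with index `w i`. -/
theorem sum_replace_row_eq_polarDet_cons {s : ℕ} (u : ι → ι → R) (v : ι → Fin s → ι → R) :
    ∑ S : ι → Finset (Fin s), (∏ i, (-1 : R) ^ (S i)ᶜ.card) *
        ∑ w : ι → Fin (s + 1), ∏ k,
          (Matrix.of fun i => if w i = k then u i else ∑ j ∈ S i, v i j).det
      = polarDet fun i => (Fin.cons (u i) (v i) : Fin (s + 1) → ι → R) := by
  rw [← sum_weight_prod_det_eq_polarDet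
      (fun x : Finset (Fin s) × Fin (s + 1) => (-1 : R) ^ x.1ᶜ.card)
      (fun x k => Fin.cons (if x.2 = k then 1 else 0)
        fun j => if x.2 = k then 0 else if j ∈ x.1 then 1 else 0) sum_weight_succ,
    ← (Equiv.arrowProdEquivProdArrow ι (fun _ => Finset (Fin s))
      (fun _ => Fin (s + 1))).symm.sum_comp, Fintype.sum_prod_type]
  refine sum_congr rfl fun S _ => ?_
  rw [mul_sum]
  refine sum_congr rfl fun w _ => ?_
  simp only [Equiv.arrowProdEquivProdArrow_symm_apply]
  congr 1
  refine prod_congr rfl fun k _ => ?_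
  congr 2
  funext i
  rw [Fin.sum_univ_succ]
  simp only [Fin.cons_zero, Fin.cons_succ]
  split_ifs <;> simp

/-- Cayley's identity in polarised form: both sides are combinations, over the same subsets `S i`
of the vectors in row `i`, of the two sides of `omegaSum_one` at the matrix with rows
`∑ j ∈ S i, v i j`. -/
theorem sum_sign_mul_polarDet_cons {s : ℕ} (v : ι → Fin s → ι → R) :
    ∑ π : Equiv.Perm ι, ((Equiv.Perm.sign π : ℤ) : R) *
        polarDet (fun i => (Fin.cons ((1 : Matrix ι ι R) (π i)) (v i) : Fin (s + 1) → ι → R))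
      = ((s + 1).ascFactorial (Fintype.card ι) : R) * polarDet v := by
  rw [← sum_det_sum_pow_eq_polarDet, mul_sum]
  simp_rw [← sum_replace_row_eq_polarDet_cons, mul_sum]
  rw [sum_comm]
  refine sum_congr rfl fun S _ => ?_
  have h := omegaSum_one s (Matrix.of fun i => ∑ j ∈ S i, v i j)
  rw [mul_left_comm, mul_comm (Nat.cast _), ← h, omegaSum]
  simp_rw [mul_sum]
  exact sum_congr rfl fun π _ => sum_congr rfl fun w _ => by rw [mul_left_comm]; rfl

/-- The value of `det(∂)^s det(X)^s`, in polarised form. -/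
theorem sum_sign_mul_polarDet_one (s : ℕ) :
    ∑ π : Fin s → Equiv.Perm ι, (∏ j, ((Equiv.Perm.sign (π j) : ℤ) : R)) *
        polarDet (fun i j => (1 : Matrix ι ι R) (π j i))
      = ∏ k ∈ range s, ((k + 1).ascFactorial (Fintype.card ι) : R) := by
  induction s with
  | zero => simp [polarDet]
  | succ s ih =>
    rw [prod_range_succ, ← ih, ← (Fin.consEquiv fun _ => Equiv.Perm ι).sum_comp,
      Fintype.sum_prod_type, sum_comm, sum_mul]
    refine sum_congr rfl fun π _ => ?_
    rw [mul_assoc, mul_comm (polarDet _), ← sum_sign_mul_polarDet_cons, mul_sum]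
    refine sum_congr rfl fun π₀ _ => ?_
    rw [Fin.prod_univ_succ]
    simp only [Fin.consEquiv_apply, Fin.cons_zero, Fin.cons_succ]
    rw [mul_assoc, mul_left_comm]
    congr 3
    funext i j
    refine Fin.cases ?_ (fun j => ?_) j <;> rfl

end Polarization

/-! ### Self-maps of a product -/

section Boxes

variable {ι κ K : Type*} [Fintype ι] [DecidableEq ι] [Fintype κ] [DecidableEq κ]
  [Fintype K] [DecidableEq K]

theorem mapSign_conj (e : ι ≃ κ) (f : ι → ι) :
    mapSign (fun x => e (f (e.symm x))) = mapSign f := by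
  rw [mapSign, mapSign, ← det_submatrix_equiv_self e]
  congr 1
  ext i j
  simp [Matrix.one_apply]

theorem mapSign_fiberwise (h : K → ι → ι) :
    mapSign (fun x : ι × K => (h x.2 x.1, x.2)) = ∏ k, mapSign (h k) := by
  simp_rw [mapSign]
  rw [← det_blockDiagonal]
  congr 1
  ext ⟨i, k⟩ ⟨j, l⟩
  by_cases hk : k = l <;> simp [Matrix.one_apply, blockDiagonal_apply, hk]

/-- The map `(i, k) ↦ (π k i, ρ i k)` factors through the permutation given by `ρ` into a map which
preserves the second coordinate. -/
theorem mapSign_prod_perm (π : K → Equiv.Perm ι) (ρ : ι → Equiv.Perm K) :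
    mapSign (fun x : ι × K => (π x.2 x.1, ρ x.1 x.2))
      = (∏ i, (Equiv.Perm.sign (ρ i) : ℤ)) * ∏ k, mapSign fun i => π ((ρ i)⁻¹ k) i := by
  have h : (fun x : ι × K => (π x.2 x.1, ρ x.1 x.2))
      = (fun x : ι × K => (π ((ρ x.1)⁻¹ x.2) x.1, x.2)) ∘ Equiv.prodCongrRight ρ := by
    funext x
    simp
  rw [h, mapSign_comp, mapSign_perm, Equiv.Perm.sign_prodCongrRight, Units.coe_prod, mul_comm]
  congr 1
  exact mapSign_fiberwise fun k i => π ((ρ i)⁻¹ k) i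

end Boxes

/-! ### Products of minors along the columns of a tableau -/

namespace Tableau

section Minors

variable {R : Type*} [CommRing R] {r c N : ℕ}

theorem colMinors_act (M : Matrix (Fin N) (Fin r) R) (σ : Equiv.Perm (Fin N))
    (t : Tableau r c N) :
    colMinors M (act σ t) = ∑ π : Fin c → Equiv.Perm (Fin r),
      (∏ j, ((Equiv.Perm.sign (π j) : ℤ) : R)) *
        ∏ k, M (σ k) (π (t.symm k).2 (t.symm k).1) := by
  rw [colMinors, prod_det_eq_sum]
  refine sum_congr rfl fun π _ => ?_
  congr 1
  rw [← t.prod_comp, Fintype.prod_prod_type, prod_comm]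
  simp [act]

/-- The minors of column-equivalent tableaux differ by the sign of the permutation of the boxes
which takes one tableau to the other. -/
theorem colMinors_of_colEquiv (M : Matrix (Fin N) (Fin r) R) {s t : Tableau r c N}
    (h : ColEquiv s t) :
    colMinors M s = ((Equiv.Perm.sign (s.trans t.symm) : ℤ) : R) * colMinors M t := by
  have hcol : ∀ i j, (t.symm (s (i, j))).2 = j := fun i j => by
    have := h (s (i, j))
    simp only [colOf, Equiv.symm_apply_apply] at this
    exact this.symm
  have hinj : ∀ j, Function.Injective fun i => (t.symm (s (i, j))).1 := by
    intro j i i' hi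
    have : t.symm (s (i, j)) = t.symm (s (i', j)) :=
      Prod.ext hi ((hcol i j).trans (hcol i' j).symm)
    exact (Prod.ext_iff.1 (s.injective (t.symm.injective this))).1
  let τ : Fin c → Equiv.Perm (Fin r) := fun j =>
    Equiv.ofBijective _ (Finite.injective_iff_bijective.1 (hinj j))
  have hτ : s.trans t.symm = Equiv.prodCongrLeft τ := by
    ext1 ⟨i, j⟩
    exact Prod.ext rfl (hcol i j)
  have hs : ∀ i j, s (i, j) = t (τ j i, j) := by
    intro i j
    have := congrArg t (Equiv.congr_fun hτ (i, j))
    simpa using this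
  rw [hτ, Equiv.Perm.sign_prodCongrLeft, Units.coe_prod, colMinors, colMinors, Int.cast_prod,
    ← prod_mul_distrib]
  refine prod_congr rfl fun j _ => ?_
  rw [← det_permute]
  simp only [hs]
  rfl

theorem colEquiv_act {s t : Tableau r c N} (h : ColEquiv s t) (σ : Equiv.Perm (Fin N)) :
    ColEquiv (act σ s) (act σ t) := fun k => h (σ.symm k)

theorem colMinors_act_of_colEquiv (M : Matrix (Fin N) (Fin r) R) {s t : Tableau r c N}
    (h : ColEquiv s t) (σ : Equiv.Perm (Fin N)) :
    colMinors M (act σ s)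
      = ((Equiv.Perm.sign (s.trans t.symm) : ℤ) : R) * colMinors M (act σ t) := by
  rw [colMinors_of_colEquiv M (colEquiv_act h σ)]
  have : (act σ s).trans (act σ t).symm = s.trans t.symm := by
    ext1 x
    simp [act]
  rw [this]

theorem colMinors_act_mul_swap (M : Matrix (Fin N) (Fin r) R) (t : Tableau r c N)
    (σ : Equiv.Perm (Fin N)) {k l : Fin N} (hkl : k ≠ l) (h : t.colOf k = t.colOf l) :
    colMinors M (act (σ * Equiv.swap k l) t) = - colMinors M (act σ t) := by
  have hcol : ColEquiv (act (Equiv.swap k l) t) t := by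
    intro x
    change t.colOf ((Equiv.swap k l).symm x) = t.colOf x
    rw [Equiv.symm_swap, Equiv.swap_apply_def]
    split_ifs with h1 h2
    · rw [h1, h]
    · rw [h2, h]
    · rfl
  have hsign : Equiv.Perm.sign ((act (Equiv.swap k l) t).trans t.symm) = -1 := by
    rw [act, Equiv.Perm.sign_trans_trans_symm, Equiv.Perm.sign_swap hkl]
  have := colMinors_act_of_colEquiv M hcol σ
  rw [hsign, Units.val_neg, Units.val_one, Int.cast_neg, Int.cast_one, neg_one_mul] at this
  exact this

end Minors

/-! ### The coefficient of the determinant of the amalgam -/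

section AmalgamSum

variable {R : Type*} [CommRing R] {m n : ℕ}

/-- The signed sum `∑ ε(σ) A_{σα} B_{σβ}` over the symmetric group. -/
def amalgamSum (A : Matrix (Fin (m * n)) (Fin m) R) (B : Matrix (Fin (m * n)) (Fin n) R)
    (α : Tableau m n (m * n)) (β : Tableau n m (m * n)) : R :=
  ∑ σ : Equiv.Perm (Fin (m * n)), ((Equiv.Perm.sign σ : ℤ) : R) *
    (colMinors A (act σ α) * colMinors B (act σ β))

/-- The coefficient of `det (A ⋆ B)` in `amalgamSum A B α β`. Expanding all minors by the Leibniz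
formula, with permutations `π j` for the columns of `α` and `ρ i` for those of `β`, gives one
self-map of the index set of the columns of `A ⋆ B` for each choice of `π` and `ρ`. -/
def amalgamCoeff (α : Tableau m n (m * n)) (β : Tableau n m (m * n)) : ℤ :=
  ∑ π : Fin n → Equiv.Perm (Fin m), ∑ ρ : Fin m → Equiv.Perm (Fin n),
    (∏ j, (Equiv.Perm.sign (π j) : ℤ)) * (∏ i, (Equiv.Perm.sign (ρ i) : ℤ)) *
      mapSign fun k => one m n (π (α.symm k).2 (α.symm k).1, ρ (β.symm k).2 (β.symm k).1)

theorem det_amalgam_mul_amalgamCoeff (A : Matrix (Fin (m * n)) (Fin m) R)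
    (B : Matrix (Fin (m * n)) (Fin n) R) (α : Tableau m n (m * n)) (β : Tableau n m (m * n)) :
    (amalgam A B).det * (amalgamCoeff α β : R) = amalgamSum A B α β := by
  rw [amalgamSum, amalgamCoeff]
  simp_rw [colMinors_act, sum_mul_sum]
  push_cast
  simp_rw [mul_sum]
  symm
  rw [sum_comm]
  refine sum_congr rfl fun π _ => ?_
  rw [sum_comm]
  refine sum_congr rfl fun ρ _ => ?_
  symm
  rw [mul_left_comm, ← det_submatrix_right, det_apply', mul_sum]
  refine sum_congr rfl fun σ _ => ?_
  have : ∀ k, (amalgam A B).submatrix id (fun k => one m n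
      (π (α.symm k).2 (α.symm k).1, ρ (β.symm k).2 (β.symm k).1)) (σ k) k
      = A (σ k) (π (α.symm k).2 (α.symm k).1) * B (σ k) (ρ (β.symm k).2 (β.symm k).1) := by
    intro k
    simp [amalgam]
  simp_rw [this, prod_mul_distrib]
  ring

/-- The coefficient is the signed sum for matrices with `A ⋆ B = 1`. -/
theorem exists_amalgamSum_eq_amalgamCoeff (m n : ℕ) :
    ∃ (A : Matrix (Fin (m * n)) (Fin m) ℤ) (B : Matrix (Fin (m * n)) (Fin n) ℤ),
      ∀ α β, amalgamSum A B α β = amalgamCoeff α β := by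
  refine ⟨Matrix.of fun k i => if ((one m n).symm k).1 = i then 1 else 0,
    Matrix.of fun k j => if ((one m n).symm k).2 = j then 1 else 0, fun α β => ?_⟩
  rw [← det_amalgam_mul_amalgamCoeff]
  have : amalgam (Matrix.of fun k i => if ((one m n).symm k).1 = i then (1 : ℤ) else 0)
      (Matrix.of fun k j => if ((one m n).symm k).2 = j then (1 : ℤ) else 0) = 1 := by
    ext k l
    have hkl : k = l ↔ ((one m n).symm k).1 = ((one m n).symm l).1 ∧
        ((one m n).symm k).2 = ((one m n).symm l).2 := by
      rw [← Prod.ext_iff, (one m n).symm.apply_eq_iff_eq]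
    simp only [amalgam, of_apply, Matrix.one_apply, hkl, ite_and]
    split_ifs <;> simp
  rw [this, det_one, one_mul, Int.cast_id]

theorem amalgamCoeff_act (τ : Equiv.Perm (Fin (m * n))) (α : Tableau m n (m * n))
    (β : Tableau n m (m * n)) :
    amalgamCoeff (act τ α) (act τ β) = (Equiv.Perm.sign τ : ℤ) * amalgamCoeff α β := by
  obtain ⟨A, B, h⟩ := exists_amalgamSum_eq_amalgamCoeff m n
  rw [← h, ← h, amalgamSum, amalgamSum, mul_sum]
  refine Fintype.sum_equiv (Equiv.mulRight τ) _ _ fun σ => ?_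
  have h1 : ∀ {r c : ℕ} (t : Tableau r c (m * n)), act σ (act τ t) = act (σ * τ) t :=
    fun t => rfl
  rw [h1, h1, Equiv.coe_mulRight, Equiv.Perm.sign_mul]
  have := perm_sign_mul_self τ
  push_cast
  linear_combination (-(Equiv.Perm.sign σ : ℤ) * (colMinors A (act (σ * τ) α)
    * colMinors B (act (σ * τ) β))) * this

theorem amalgamCoeff_of_colEquiv {α γ : Tableau m n (m * n)} {β δ : Tableau n m (m * n)}
    (hα : ColEquiv γ α) (hβ : ColEquiv δ β) :
    amalgamCoeff γ δ = (Equiv.Perm.sign (γ.trans α.symm) : ℤ) *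
      (Equiv.Perm.sign (δ.trans β.symm) : ℤ) * amalgamCoeff α β := by
  obtain ⟨A, B, h⟩ := exists_amalgamSum_eq_amalgamCoeff m n
  rw [← h, ← h, amalgamSum, amalgamSum, mul_sum]
  refine sum_congr rfl fun σ _ => ?_
  rw [colMinors_act_of_colEquiv A hα, colMinors_act_of_colEquiv B hβ]
  simp only [Int.cast_id]
  ring

/-- Multiplying `σ` by the transposition of a common column pair changes the sign of `ε(σ)` and of
both products of minors, so the terms cancel in pairs. -/
theorem amalgamCoeff_eq_zero {α : Tableau m n (m * n)} {β : Tableau n m (m * n)}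
    (h : CommonColPair α β) : amalgamCoeff α β = 0 := by
  obtain ⟨A, B, hAB⟩ := exists_amalgamSum_eq_amalgamCoeff m n
  obtain ⟨k, l, hkl, hα, hβ⟩ := h
  rw [← hAB, amalgamSum]
  refine self_eq_neg.1 ?_
  rw [← sum_neg_distrib]
  refine Fintype.sum_equiv (Equiv.mulRight (Equiv.swap k l)) _ _ fun σ => ?_
  rw [Equiv.coe_mulRight, colMinors_act_mul_swap A α σ hkl hα, colMinors_act_mul_swap B β σ hkl hβ,
    Equiv.Perm.sign_mul, Equiv.Perm.sign_swap hkl]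
  simp

/-- The coefficient of the pair `1_{n^m}`, `(1_{n^m})'` is the value of `det(∂)^n det(X)^n` for
the `m × m` determinant. -/
theorem amalgamCoeff_one (m n : ℕ) :
    amalgamCoeff (one m n) (one m n).conj = ∏ k ∈ range n, ((k + 1).ascFactorial m : ℤ) := by
  have h := sum_sign_mul_polarDet_one (ι := Fin m) (R := ℤ) n
  rw [Fintype.card_fin] at h
  rw [← h, amalgamCoeff]
  refine sum_congr rfl fun π _ => ?_
  rw [polarDet, mul_sum]
  refine Fintype.sum_equiv (Equiv.inv (Fin m → Equiv.Perm (Fin n))) _ _ fun ρ => ?_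
  have h1 := mapSign_conj (one m n) fun x : Fin m × Fin n => (π x.2 x.1, ρ x.1 x.2)
  have h2 : (fun k => one m n (π ((one m n).symm k).2 ((one m n).symm k).1,
      ρ ((one m n).conj.symm k).2 ((one m n).conj.symm k).1))
      = fun k => one m n ((fun x : Fin m × Fin n => (π x.2 x.1, ρ x.1 x.2))
        ((one m n).symm k)) := rfl
  rw [h2, h1, mapSign_prod_perm]
  have h3 : (∏ i, (Equiv.Perm.sign (ρ i) : ℤ)) * (∏ i, (Equiv.Perm.sign (ρ i) : ℤ)) = 1 := by
    rw [← prod_mul_distrib]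
    exact prod_eq_one fun i _ => perm_sign_mul_self _
  simp only [Int.cast_id]
  rw [mul_assoc, ← mul_assoc (∏ i, (Equiv.Perm.sign (ρ i) : ℤ)), h3, one_mul]
  rfl

theorem amalgamCoeff_ne_zero {α : Tableau m n (m * n)} {β : Tableau n m (m * n)}
    (h : ¬ CommonColPair α β) : amalgamCoeff α β ≠ 0 := by
  obtain ⟨γ, ⟨h1, h2⟩, -⟩ := existsUnique_colEquiv h
  have h3 := amalgamCoeff_of_colEquiv h1 h2
  have h4 := amalgamCoeff_act ((one m n).symm.trans γ) (one m n) (one m n).conj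
  have h5 : act ((one m n).symm.trans γ) (one m n) = γ := by
    ext1 x; simp [act]
  have h6 : act ((one m n).symm.trans γ) (one m n).conj = γ.conj := by
    ext1 x; simp [act, conj]
  rw [h5, h6, amalgamCoeff_one, h3] at h4
  intro h0
  rw [h0, mul_zero] at h4
  refine mul_ne_zero (Units.ne_zero _) (prod_ne_zero_iff.2 fun k _ => ?_) h4.symm
  exact_mod_cast (Nat.ascFactorial_pos k m).ne'

theorem fayers_eq_zero_iff (α : Tableau m n (m * n)) (β : Tableau n m (m * n)) :
    fayers α β = 0 ↔ CommonColPair α β := by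
  rw [fayers]
  split_ifs with h
  · simp [h]
  · simp [h, sign]

end AmalgamSum

end Tableau

/-! ### Hook lengths of a rectangle -/

section HookLengths

theorem hookNumber_eq_prod_ascFactorial (m n : ℕ) :
    hookNumber m n = ((∏ k ∈ range n, (k + 1).ascFactorial m : ℕ) : ℚ) := by
  rw [hookNumber, Nat.cast_prod]
  refine prod_congr rfl fun k _ => ?_
  rw [div_eq_iff (by exact_mod_cast k.factorial_ne_zero), add_comm m k,
    ← Nat.factorial_mul_ascFactorial]
  push_cast
  ring

theorem hookLength_eq {m n : ℕ} (i : Fin m) (j : Fin n) :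
    hookLength (i, j) = (j.rev : ℕ) + 1 + (i.rev : ℕ) := by
  have h : (univ.filter fun y : Fin m × Fin n => (y.1 = i ∧ j ≤ y.2) ∨ (y.2 = j ∧ i ≤ y.1))
      = ({i} ×ˢ Ici j) ∪ (Ioi i ×ˢ {j}) := by
    ext ⟨a, b⟩
    simp only [mem_filter, mem_univ, true_and, mem_union, mem_product, mem_singleton, mem_Ici,
      mem_Ioi]
    grind
  have hd : Disjoint (({i} : Finset (Fin m)) ×ˢ Ici j) (Ioi i ×ˢ {j}) := by
    rw [Finset.disjoint_left]
    rintro ⟨a, b⟩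
    simp only [mem_product, mem_singleton, mem_Ici, mem_Ioi]
    grind
  rw [hookLength, h, card_union_of_disjoint hd, card_product, card_product, Fin.card_Ici,
    Fin.card_Ioi, Fin.val_rev, Fin.val_rev, card_singleton, card_singleton]
  omega

theorem ascFactorial_succ_eq_prod (a m : ℕ) :
    (a + 1).ascFactorial m = ∏ i : Fin m, (a + 1 + (i : ℕ)) := by
  rw [Nat.ascFactorial_eq_prod_range, prod_range]

theorem prod_hookLength (m n : ℕ) :
    ∏ x : Fin m × Fin n, hookLength x = ∏ k ∈ range n, (k + 1).ascFactorial m := by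
  rw [Fintype.prod_prod_type, prod_comm, prod_range, ← Equiv.prod_comp Fin.revPerm]
  refine prod_congr rfl fun j _ => ?_
  rw [ascFactorial_succ_eq_prod, ← Equiv.prod_comp Fin.revPerm]
  simp [hookLength_eq]

end HookLengths

theorem theorem4 (m n : ℕ) (hm : 1 ≤ m) (hn : 1 ≤ n) :
    ∃ κ : StandardTableau m n (m * n) → StandardTableau n m (m * n) → ℤ,
      (∀ (α : StandardTableau m n (m * n)) (β : StandardTableau n m (m * n))
        (R : Type*) [CommRing R]
        (A : Matrix (Fin (m * n)) (Fin m) R) (B : Matrix (Fin (m * n)) (Fin n) R),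
        (amalgam A B).det * (κ α β : R) =
          ∑ σ : Equiv.Perm (Fin (m * n)), ((Equiv.Perm.sign σ : ℤ) : R) *
            (Tableau.colMinors A (Tableau.act σ α.1) *
              Tableau.colMinors B (Tableau.act σ β.1))) ∧
      (∀ (α : StandardTableau m n (m * n)) (β : StandardTableau n m (m * n)),
        κ α β = 0 ↔ Tableau.fayers α.1 β.1 = 0) ∧
      (n ≤ m →
        (κ (StandardTableau.one m n) (StandardTableau.one m n).conj : ℚ) = hookNumber m n ∧
        hookNumber m n = ((∏ x : Fin m × Fin n, hookLength x : ℕ) : ℚ)) := by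
  refine ⟨fun α β => Tableau.amalgamCoeff α.1 β.1, fun α β R _ A B =>
    Tableau.det_amalgam_mul_amalgamCoeff A B α.1 β.1, fun α β => ?_, fun _ => ⟨?_, ?_⟩⟩
  · rw [Tableau.fayers_eq_zero_iff]
    exact ⟨fun h => by_contra fun hc => Tableau.amalgamCoeff_ne_zero hc h,
      Tableau.amalgamCoeff_eq_zero⟩
  · rw [hookNumber_eq_prod_ascFactorial]
    exact_mod_cast Tableau.amalgamCoeff_one m n
  · rw [hookNumber_eq_prod_ascFactorial, prod_hookLength]
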